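/- Represent a pure state with finitely many photons in $N$ bosonic modes as $P(a_1^\dagger,\dots,a_N^\dagger)|0\rangle$ with $P$ a polynomial over $\mathbb C$; in particular $|k_1,\dots,k_N\rangle=\prod_i \frac{1}{\sqrt{k_i!}}(a_i^\dagger)^{k_i}|0\rangle$. An $n$-photon state is *separable* if its polynomial is nonzero, homogeneous of degree $n$, and of the form $\prod_i p_i(a_i^\dagger)$ with univariate $p_i$. A complex matrix $A\in\mathbb C^{N\times N}$ (not necessarily unitary) acts on states by $a_i^\dagger\mapsto\sum_j A_{ij}a_j^\dagger$. If $F$ is the output polynomial and $N=T+M$, then heralding on the pattern $(m_1,\dots,m_M)$ in the last $M$ modes leaves the unnormalized state of the first $T$ modes with polynomial $$G=\frac{1}{\prod_j m_j!}\,\frac{\partial^{\,m_1+\dots+m_M}F}{\partial (a_{T+1}^\dagger)^{m_1}\cdots\partial (a_{T+M}^\dagger)^{m_M}}\Bigg|_{a_{T+1}^\dagger=\dots=a_{T+M}^\dagger=0}.$$ The transformation $A$ heralds the target state with polynomial $Q$ if $G=\alpha Q$ for some $\alpha\in\mathbb C\setminus\{0\}$. The dual-rail Bell states are the four-mode states $(|1,0,1,0\rangle\pm|0,1,0,1\rangle)/\sqrt2$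 and $(|1,0,0,1\rangle\pm|0,1,1,0\rangle)/\sqrt2$. 1. Take the input $|1,1,1,0,0\rangle$, the heralding pattern $(1)$ on the fifth mode, and the target $(|1,0,1,0\rangle+|0,1,0,1\rangle)/\sqrt2$ with polynomial $Q$. Let $G$ be the heralded polynomial for the $5\times5$ transformation with unknown entries $A_{ij}$. For every $\gamma\in\mathbb C\setminus\{0\}$, the system $f_c=0$ in $\mathbb C[A_{ij}]$, where $f_c$ is the coefficient of $\gamma G-Q$ at $c$ and $c$ runs over the ten monomials of degree $2$ in $a_1^\dagger,\dots,a_4^\dagger$, has a Nullstellensatz certificate $1=\sum_c\beta_c f_c$ of degree $\max_c\deg\beta_c=9$. 2. No $A\in\mathbb C^{5\times 5}$ heralds $(|1,0,1,0\rangle+|0,1,0,1\rangle)/\sqrt2$ from $|1,1,1,0,0\rangle$ with heralding pattern $(1)$. 3. Let $|\Psi\rangle$ be any dual-rail Bell state. For no $M\ge0$, no separable three-photon input state on $4+M$ modes, no heralding pattern on the last $M$ modes and no $A\in\mathbb C^{(4+M)\times(4+M)}$ does $A$ herald $|\Psi\rangle$. 4. Four photons are optimal: for every dual-rail Bell state $|\Psi\rangle$,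 the least $n$ such that $|\Psi\rangle$ can be heralded from a separable $n$-photon input on $4+M$ modes (for some $M$, some heralding pattern on the last $M$ modes and some complex matrix $A$) is $4$. The least $n$ is also $4$ if only Fock state inputs $|k_1,\dots,k_{4+M}\rangle$ with $\sum_i k_i=n$ and unitary matrices are allowed. -/

import Mathlib

open MvPolynomial

noncomputable section

namespace LinearOptics

/-! A pure state of finitely many bosonic modes with finitely many photons is written as
`P(a₁†, …, a_N†)|0⟩`, and is represented by the polynomial `P`, the variable `X i` standing for the
creation operator of mode `i`. -/

/-- The Fock state `|k₁, …, k_N⟩ = ∏ᵢ (aᵢ†)^{kᵢ} / √(kᵢ!) |0⟩`. -/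
def fock {N : ℕ} (k : Fin N → ℕ) : MvPolynomial (Fin N) ℂ :=
  ∏ i, C ((Real.sqrt ((k i).factorial : ℝ) : ℂ)⁻¹) * X i ^ k i

/-- `R` is a (nonzero) `n`-photon state vector that is separable, that is, a product
`∏ᵢ pᵢ(aᵢ†)|0⟩` of single-mode states. -/
def IsSeparable {N : ℕ} (n : ℕ) (R : MvPolynomial (Fin N) ℂ) : Prop :=
  R ≠ 0 ∧ R.IsHomogeneous n ∧
    ∃ p : Fin N → Polynomial ℂ, R = ∏ i, Polynomial.aeval (X i : MvPolynomial (Fin N) ℂ) (p i)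

/-- The output state of the linear transformation `aᵢ† ↦ ∑ⱼ Aᵢⱼ aⱼ†` on the input state `R`. The
entries of `A` may lie in any commutative `ℂ`-algebra `S`: complex numbers for an actual
transformation, polynomial variables for an unknown one. -/
def output {S : Type*} [CommRing S] [Algebra ℂ S] {N : ℕ} (A : Matrix (Fin N) (Fin N) S)
    (R : MvPolynomial (Fin N) ℂ) : MvPolynomial (Fin N) S :=
  aeval (fun i => ∑ j, C (A i j) * X j) R

/-- A polynomial in the creation operators of `T + M` modes, regarded as a polynomial in those of
the last `M` modes, with coefficients that are polynomials in those of the first `T` modes. -/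
def splitModes {S : Type*} [CommRing S] {T M : ℕ} :
    MvPolynomial (Fin (T + M)) S →ₐ[S] MvPolynomial (Fin M) (MvPolynomial (Fin T) S) :=
  aeval (Fin.addCases (fun i => C (X i)) (fun j => X j))

/-- The (unnormalized) state of the first `T` modes, conditional on detecting `m j` photons in the
`j`-th of the last `M` modes: the coefficient of `∏ⱼ (a_{T+j}†)^{m j}` in the output polynomial `F`,
which is `(∏ⱼ (m j)!)⁻¹ ∂^m F / ∂a_{T+1}†^{m 1} ⋯ ∂a_{T+M}†^{m M}` at
`a_{T+1}† = ⋯ = a_{T+M}† = 0`. -/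
def heralded {S : Type*} [CommRing S] [Algebra ℂ S] {T M : ℕ}
    (A : Matrix (Fin (T + M)) (Fin (T + M)) S) (R : MvPolynomial (Fin (T + M)) ℂ)
    (m : Fin M → ℕ) : MvPolynomial (Fin T) S :=
  coeff (Finsupp.equivFunOnFinite.symm m) (splitModes (output A R))

/-- On the input `R`, the linear transformation `A` with heralding pattern `m` on the last `M` modes
produces the target state `Q`, up to a nonzero scalar (whose square modulus is the success
probability). -/
def Heralds {T M : ℕ} (A : Matrix (Fin (T + M)) (Fin (T + M)) ℂ)
    (R : MvPolynomial (Fin (T + M)) ℂ) (m : Fin M → ℕ) (Q : MvPolynomial (Fin T) ℂ) : Prop :=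
  ∃ α : ℂ, α ≠ 0 ∧ heralded A R m = C α * Q

/-- The coefficient at the monomial `c` of `γ G - Q`, where `G` is the heralded state as a function
of an unknown transformation: a polynomial in the matrix entries `Aᵢⱼ`. -/
def stateEquation {T M : ℕ} (γ : ℂ) (R : MvPolynomial (Fin (T + M)) ℂ) (m : Fin M → ℕ)
    (Q : MvPolynomial (Fin T) ℂ) (c : Fin T →₀ ℕ) :
    MvPolynomial (Fin (T + M) × Fin (T + M)) ℂ :=
  C γ * coeff c (heralded (Matrix.mvPolynomialX (Fin (T + M)) (Fin (T + M)) ℂ) R m) - C (coeff c Q)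

/-- The system `f i = 0`, `i ∈ s`, has a Nullstellensatz certificate `1 = ∑ᵢ βᵢ fᵢ` of degree `d`,
that is, with `maxᵢ deg βᵢ = d`. -/
def HasCertificateOfDegree {ι σ K : Type*} [Field K] (s : Finset ι) (f : ι → MvPolynomial σ K)
    (d : ℕ) : Prop :=
  ∃ β : ι → MvPolynomial σ K,
    ∑ i ∈ s, β i * f i = 1 ∧ s.sup (fun i => (β i).totalDegree) = d

/-- The dual-rail Bell state `(|1,0,1,0⟩ + |0,1,0,1⟩)/√2`. -/
def bell : MvPolynomial (Fin 4) ℂ :=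
  C ((Real.sqrt 2 : ℂ)⁻¹) * (fock ![1, 0, 1, 0] + fock ![0, 1, 0, 1])

/-- The four dual-rail Bell states. -/
def bellStates : Set (MvPolynomial (Fin 4) ℂ) :=
  {bell,
   C ((Real.sqrt 2 : ℂ)⁻¹) * (fock ![1, 0, 1, 0] - fock ![0, 1, 0, 1]),
   C ((Real.sqrt 2 : ℂ)⁻¹) * (fock ![1, 0, 0, 1] + fock ![0, 1, 1, 0]),
   C ((Real.sqrt 2 : ℂ)⁻¹) * (fock ![1, 0, 0, 1] - fock ![0, 1, 1, 0])}

end LinearOptics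

end

open MvPolynomial

namespace LinearOptics

/-! A separable `n`-photon input has at most `n` nonconstant factors, so the output involves the `T`
target modes only through the linear forms given by at most `n` rows of `A`. If `n < T`, these forms
have a common zero `v ≠ 0`, and every heralded polynomial is invariant under translation by `v`
(`IsSeparable.exists_translate_heralded`). A Bell state is a nondegenerate quadratic form in four
variables, so only `v = 0` leaves it invariant; hence `n ≥ 4`.

Four photons suffice by interference: in `heralded_interferometer` the Hadamard signs cancel all but
two terms and leave a multiple of `l₁ l₃ - l₀ l₂`, where the `lᵢ` are freely chosen orthonormal
forms.

The certificate makes nondegeneracy algebraic. The three-photon heralded form has singular Hessian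
(`det_hessian_three`), while that of the target has determinant `1/4`. Writing the difference of the
two determinants through the equations (`sum_cofactor`) gives cofactors cubic in coefficients that
are themselves cubic in the matrix entries, hence degree 9. -/

theorem splitModes_output {S : Type*} [CommRing S] [Algebra ℂ S] {T M : ℕ}
    (A : Matrix (Fin (T + M)) (Fin (T + M)) S) (R : MvPolynomial (Fin (T + M)) ℂ) :
    splitModes (output A R) =
      aeval (fun i => C (∑ j, C (A i (Fin.castAdd M j)) * X j) +
        ∑ j, C (C (A i (Fin.natAdd T j))) * X j) R := by
  rw [output, ← AlgHom.restrictScalars_apply ℂ (splitModes (S := S) (T := T) (M := M)),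
    ← AlgHom.comp_apply, MvPolynomial.comp_aeval]
  congr 2
  funext i
  have hC : ∀ a : S, splitModes (S := S) (T := T) (M := M) (C a) = C (C a) := fun a => by
    rw [← algebraMap_eq, AlgHom.commutes]; rfl
  have hX : ∀ k, splitModes (S := S) (T := T) (M := M) (X k) =
      Fin.addCases (fun i => C (X i)) (fun j => X j) k := fun k => aeval_X _ k
  simp only [AlgHom.restrictScalars_apply, Fin.sum_univ_add, map_add, map_sum, map_mul, hC, hX,
    Fin.addCases_left, Fin.addCases_right]

/-! ### Translation invariance and the lower bound -/

/-- The substitution `a_j† ↦ a_j† + v_j`. -/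
noncomputable def translate {T : ℕ} (v : Fin T → ℂ) :
    MvPolynomial (Fin T) ℂ →ₐ[ℂ] MvPolynomial (Fin T) ℂ :=
  aeval fun j => X j + C (v j)

theorem natDegree_le_totalDegree_aeval_X {σ : Type*} (i : σ) (p : Polynomial ℂ) :
    p.natDegree ≤ (Polynomial.aeval (X i : MvPolynomial σ ℂ) p).totalDegree := by
  have h : aeval (fun _ => Polynomial.X) (Polynomial.aeval (X i : MvPolynomial σ ℂ) p) = p := by
    rw [← Polynomial.aeval_algHom_apply, aeval_X, Polynomial.aeval_X_left_apply]
  conv_lhs => rw [← h]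
  simpa using aeval_natDegree_le _ le_rfl _ (n := 1) (fun _ => Polynomial.natDegree_X_le)

/-- Total degrees add over a domain, so the degrees of the factors sum to at most `n`, and each
nonconstant factor contributes at least one. -/
theorem IsSeparable.exists_card_le {N n : ℕ} {R : MvPolynomial (Fin N) ℂ} (h : IsSeparable n R) :
    ∃ p : Fin N → Polynomial ℂ, R = ∏ i, Polynomial.aeval (X i : MvPolynomial (Fin N) ℂ) (p i) ∧
      (Finset.univ.filter fun i => (p i).natDegree ≠ 0).card ≤ n := by
  obtain ⟨h0, hn, p, rfl⟩ := h
  refine ⟨p, rfl, ?_⟩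
  have h1 := hn.totalDegree h0
  have hne := fun i => Finset.prod_ne_zero_iff.1 h0 i (Finset.mem_univ i)
  have h2 : ∀ s : Finset (Fin N), ∑ i ∈ s, (p i).natDegree ≤
      (∏ i ∈ s, Polynomial.aeval (X i : MvPolynomial (Fin N) ℂ) (p i)).totalDegree := by
    intro s
    induction s using Finset.induction_on with
    | empty => simp
    | insert a s ha ih =>
      rw [Finset.prod_insert ha, Finset.sum_insert ha,
        totalDegree_mul_of_isDomain (hne a) (Finset.prod_ne_zero_iff.2 fun i _ => hne i)]
      exact add_le_add (natDegree_le_totalDegree_aeval_X a _) ih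
  refine le_trans ?_ ((h2 Finset.univ).trans h1.le)
  rw [Finset.card_eq_sum_ones, Finset.sum_filter]
  refine Finset.sum_le_sum fun i _ => ?_
  split_ifs <;> omega

theorem IsSeparable.exists_translate_heralded {T M n : ℕ} {R : MvPolynomial (Fin (T + M)) ℂ}
    (h : IsSeparable n R) (hn : n < T) (A : Matrix (Fin (T + M)) (Fin (T + M)) ℂ) :
    ∃ v : Fin T → ℂ, v ≠ 0 ∧ ∀ m, translate v (heralded A R m) = heralded A R m := by
  obtain ⟨p, rfl, hp⟩ := h.exists_card_le
  set s := Finset.univ.filter fun i => (p i).natDegree ≠ 0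
  -- Only the rows in `s` matter: at most `n < T` equations in `T` unknowns.
  obtain ⟨v, hv0, hv⟩ : ∃ v : Fin T → ℂ, v ≠ 0 ∧
      Matrix.mulVec (Matrix.of fun (i : s) j => A i (Fin.castAdd M j)) v = 0 := by
    obtain ⟨v, h1, h2⟩ := Submodule.exists_mem_ne_zero_of_ne_bot
      (LinearMap.ker_ne_bot_of_finrank_lt (f := Matrix.mulVecLin
        (Matrix.of fun (i : s) (j : Fin T) => A i (Fin.castAdd M j))) (by
          simp; omega))
    exact ⟨v, h2, h1⟩
  refine ⟨v, hv0, fun m => ?_⟩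
  rw [heralded, splitModes_output]
  -- Translation acts on the coefficients only, so it commutes with heralding and can be checked
  -- factor by factor.
  have key : ∀ P : MvPolynomial (Fin M) (MvPolynomial (Fin T) ℂ),
      translate v (coeff (Finsupp.equivFunOnFinite.symm m) P) =
      coeff (Finsupp.equivFunOnFinite.symm m) (mapAlgHom (translate v) P) := by
    intro P
    rw [mapAlgHom_apply, coeff_map]; rfl
  rw [key]
  congr 1
  simp only [map_prod]
  refine Finset.prod_congr rfl fun i _ => ?_
  rw [← Polynomial.aeval_algHom_apply, ← Polynomial.aeval_algHom_apply]
  by_cases hi : (p i).natDegree = 0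
  · obtain ⟨c, hc⟩ := Polynomial.natDegree_eq_zero.1 hi
    rw [← hc]; simp
  · congr 1
    have hz := congrFun hv ⟨i, by simp [s, hi]⟩
    simp only [Matrix.mulVec, dotProduct, Matrix.of_apply, Pi.zero_apply] at hz
    have hl : translate v (∑ j, C (A i (Fin.castAdd M j)) * X j) =
        ∑ j, C (A i (Fin.castAdd M j)) * X j := by
      simp only [map_sum, map_mul, translate, aeval_X, algHom_C, mul_add, Finset.sum_add_distrib,
        add_eq_left, algebraMap_eq]
      simp only [← map_mul, ← map_sum, hz, map_zero]
    have hC : ∀ a, mapAlgHom (σ := Fin M) (translate v) (C a) = C (translate v a) := fun a => by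
      rw [mapAlgHom_apply, map_C]; rfl
    have hX : ∀ k, mapAlgHom (σ := Fin M) (translate v) (X k) = X k := fun k => by
      rw [mapAlgHom_apply, map_X]
    have hCC : ∀ a, translate v (C a) = C a := fun a => algHom_C _ a
    rw [aeval_X, map_add, hC, hl]
    simp only [map_sum, map_mul, hC, hX, hCC]

/-- Comparing `Q (x + v) = Q x` at `0` and at the basis vectors shows that `v` pairs to zero with
each basis vector under the polar form, which is nondegenerate. -/
theorem eq_zero_of_translate_bellStates {Q : MvPolynomial (Fin 4) ℂ} (hQ : Q ∈ bellStates)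
    {v : Fin 4 → ℂ} (h : translate v Q = Q) : v = 0 := by
  have key : ∀ x : Fin 4 → ℂ, eval (x + v) Q = eval x Q := by
    intro x
    have hx : (aeval x).comp (translate v) = aeval (x + v) := by
      ext i; simp [translate]
    have := DFunLike.congr_fun hx Q
    rw [AlgHom.comp_apply, h] at this
    simpa [aeval_eq_eval] using this.symm
  have hs : (Real.sqrt 2 : ℂ) ≠ 0 := by exact_mod_cast (Real.sqrt_pos.2 two_pos).ne'
  have k0 := key 0
  have k1 := fun i => key (Pi.single i 1)
  rw [Fin.forall_fin_succ, Fin.forall_fin_succ, Fin.forall_fin_succ, Fin.forall_fin_succ] at k1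
  obtain ⟨k1, k2, k3, k4, -⟩ := k1
  rcases hQ with rfl | rfl | rfl | rfl <;>
  · simp [bell, fock, Fin.prod_univ_four, hs] at k0 k1 k2 k3 k4
    funext i
    fin_cases i <;> simp <;> grind

theorem IsSeparable.not_heralds {Q : MvPolynomial (Fin 4) ℂ} (hQ : Q ∈ bellStates) {M n : ℕ}
    {R : MvPolynomial (Fin (4 + M)) ℂ} (h : IsSeparable n R) (hn : n < 4) (m : Fin M → ℕ)
    (A : Matrix (Fin (4 + M)) (Fin (4 + M)) ℂ) : ¬ Heralds A R m Q := by
  rintro ⟨α, hα, hG⟩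
  obtain ⟨v, hv, hv'⟩ := h.exists_translate_heralded hn A
  have := hv' m
  rw [hG, map_mul, algHom_C, algebraMap_eq] at this
  exact hv (eq_zero_of_translate_bellStates hQ (mul_left_cancel₀ (by simpa using hα) this))

theorem isSeparable_fock {N : ℕ} (k : Fin N → ℕ) : IsSeparable (∑ i, k i) (fock k) := by
  have hne : ∀ i, ((Real.sqrt ((k i).factorial : ℝ) : ℂ)⁻¹) ≠ 0 := fun i =>
    inv_ne_zero (by exact_mod_cast (Real.sqrt_pos.2 (by positivity)).ne')
  refine ⟨Finset.prod_ne_zero_iff.2 fun i _ => mul_ne_zero (by simpa using hne i)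
      (pow_ne_zero _ (X_ne_zero i)), IsHomogeneous.prod _ _ _ fun i _ => ?_,
    fun i => Polynomial.C ((Real.sqrt ((k i).factorial : ℝ) : ℂ)⁻¹) * Polynomial.X ^ k i, ?_⟩
  · simpa using (isHomogeneous_C (Fin N) ((Real.sqrt ((k i).factorial : ℝ) : ℂ)⁻¹)).mul
      (isHomogeneous_X_pow (R := ℂ) i (k i))
  · simp [fock, algebraMap_eq]

/-! ### Coefficients of products of linear forms -/

theorem coeff_mul_X_update {ι S : Type*} [Fintype ι] [DecidableEq ι] [CommSemiring S] (m : ι → ℕ)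
    (p : MvPolynomial ι S) (j : ι) :
    coeff (Finsupp.equivFunOnFinite.symm m) (p * X j) =
      if m j = 0 then 0
      else coeff (Finsupp.equivFunOnFinite.symm (Function.update m j (m j - 1))) p := by
  rw [coeff_mul_X']
  by_cases h : m j = 0
  · simp [h]
  · rw [if_pos (by simpa using h), if_neg h]
    congr 1
    ext i
    by_cases hi : i = j
    · subst hi; simp
    · simp [hi]

/-- Recursion that evaluates heralded coefficients: the last photon either stays in the target modes
or is detected in mode `j`. -/
theorem coeff_mul_linear {ι S : Type*} [Fintype ι] [DecidableEq ι] [CommSemiring S] (m : ι → ℕ)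
    (p : MvPolynomial ι S) (l : S) (a : ι → S) :
    coeff (Finsupp.equivFunOnFinite.symm m) (p * (C l + ∑ j, C (a j) * X j)) =
      coeff (Finsupp.equivFunOnFinite.symm m) p * l + ∑ j, if m j = 0 then 0
        else coeff (Finsupp.equivFunOnFinite.symm (Function.update m j (m j - 1))) p * a j := by
  rw [mul_add, coeff_add, mul_comm p (C l), coeff_C_mul, mul_comm l, Finset.mul_sum, coeff_sum]
  congr 1
  refine Finset.sum_congr rfl fun j _ => ?_
  rw [← mul_assoc, coeff_mul_X_update]
  split_ifs
  · rfl
  · rw [mul_comm p, coeff_C_mul, mul_comm]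

theorem coeff_one_equivFunOnFinite {ι S : Type*} [Fintype ι] [DecidableEq ι] [CommSemiring S]
    (m : ι → ℕ) :
    coeff (Finsupp.equivFunOnFinite.symm m) (1 : MvPolynomial ι S) = if m = 0 then 1 else 0 := by
  rw [coeff_one]
  congr 1
  rw [eq_iff_iff, eq_comm, Equiv.symm_apply_eq]
  rfl

/-! ### The four-photon unitary -/

/-- Half a Hadamard matrix. -/
noncomputable def hadamard : Matrix (Fin 4) (Fin 4) ℂ :=
  !![1/2, 1/2, 1/2, 1/2; 1/2, -1/2, 1/2, -1/2; 1/2, 1/2, -1/2, -1/2; 1/2, -1/2, -1/2, 1/2]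

theorem hadamard_mul_conjTranspose : hadamard * hadamard.conjTranspose = 1 := by
  ext i j
  fin_cases i <;> fin_cases j <;>
    simp [hadamard, Matrix.mul_apply, Fin.sum_univ_four, Matrix.conjTranspose_apply,
      map_ofNat] <;>
    norm_num

/-- The block matrix with rows `(3/5 D, 4/5 H)` and `(4/5 D, -3/5 H)`, where `H` is half a Hadamard
matrix; it is unitary if `D` is. -/
noncomputable def interferometer (D : Matrix (Fin 4) (Fin 4) ℂ) :
    Matrix (Fin (4 + 4)) (Fin (4 + 4)) ℂ :=
  (Matrix.fromBlocks ((3 / 5 : ℂ) • D) ((4 / 5 : ℂ) • hadamard) ((4 / 5 : ℂ) • D)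
    (-(3 / 5 : ℂ) • hadamard)).reindex finSumFinEquiv finSumFinEquiv

theorem interferometer_mem_unitaryGroup {D : Matrix (Fin 4) (Fin 4) ℂ}
    (hD : D * D.conjTranspose = 1) :
    interferometer D ∈ Matrix.unitaryGroup (Fin (4 + 4)) ℂ := by
  rw [Matrix.mem_unitaryGroup_iff, Matrix.star_eq_conjTranspose, interferometer,
    Matrix.reindex_apply, Matrix.conjTranspose_submatrix, Matrix.submatrix_mul_equiv,
    Matrix.fromBlocks_conjTranspose, Matrix.fromBlocks_multiply]
  simp only [Matrix.conjTranspose_smul, Matrix.smul_mul, Matrix.mul_smul, smul_smul, hD,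
    hadamard_mul_conjTranspose, ← add_smul]
  have h34 : star (3 / 5 : ℂ) = 3 / 5 ∧ star (4 / 5 : ℂ) = 4 / 5 ∧
      star (-(3 / 5) : ℂ) = -(3 / 5) := by
    simp
  rw [h34.1, h34.2.1, h34.2.2]
  norm_num

theorem interferometer_castAdd_castAdd (D : Matrix (Fin 4) (Fin 4) ℂ) (i j : Fin 4) :
    interferometer D (Fin.castAdd 4 i) (Fin.castAdd 4 j) = 3 / 5 * D i j := by
  rw [interferometer, Matrix.reindex_apply, Matrix.submatrix_apply,
    finSumFinEquiv_symm_apply_castAdd, finSumFinEquiv_symm_apply_castAdd]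
  rfl

theorem interferometer_castAdd_natAdd (D : Matrix (Fin 4) (Fin 4) ℂ) (i j : Fin 4) :
    interferometer D (Fin.castAdd 4 i) (Fin.natAdd 4 j) = 4 / 5 * hadamard i j := by
  rw [interferometer, Matrix.reindex_apply, Matrix.submatrix_apply,
    finSumFinEquiv_symm_apply_castAdd, finSumFinEquiv_symm_apply_natAdd]
  rfl

theorem fock_ones_zeros :
    (fock ![1, 1, 1, 1, 0, 0, 0, 0] : MvPolynomial (Fin (4 + 4)) ℂ) =
      X (Fin.castAdd 4 0) * X (Fin.castAdd 4 1) * X (Fin.castAdd 4 2) * X (Fin.castAdd 4 3) := by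
  simp [fock, Fin.prod_univ_eight]

/-- The first two Hadamard columns are constant and alternating, so detected pairs of rows of
opposite parity cancel. Only the pairs `{0, 2}` and `{1, 3}` survive, with opposite signs and weight
`(3/5)² (4/5)² / 2 = 72/625`. -/
theorem heralded_interferometer (D : Matrix (Fin 4) (Fin 4) ℂ) :
    heralded (interferometer D) (fock ![1, 1, 1, 1, 0, 0, 0, 0]) ![1, 1, 0, 0] =
      C (72 / 625) * ((∑ j, C (D 1 j) * X j) * (∑ j, C (D 3 j) * X j) -
        (∑ j, C (D 0 j) * X j) * ∑ j, C (D 2 j) * X j) := by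
  have hl : ∀ i, (∑ j, C (interferometer D (Fin.castAdd 4 i) (Fin.castAdd 4 j)) * X j :
      MvPolynomial (Fin 4) ℂ) = C (3 / 5) * ∑ j, C (D i j) * X j := fun i => by
    simp only [interferometer_castAdd_castAdd, Finset.mul_sum, map_mul, mul_assoc]
  rw [heralded, splitModes_output, fock_ones_zeros]
  simp only [map_mul (aeval _), aeval_X, hl, interferometer_castAdd_natAdd]
  -- The leading `1` is the base case of the recursion `coeff_mul_linear`.
  rw [← one_mul (C (C (3 / 5) * ∑ j, C (D 0 j) * X j) + _)]
  generalize (∑ j, C (D 0 j) * X j : MvPolynomial (Fin 4) ℂ) = l0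
  generalize (∑ j, C (D 1 j) * X j : MvPolynomial (Fin 4) ℂ) = l1
  generalize (∑ j, C (D 2 j) * X j : MvPolynomial (Fin 4) ℂ) = l2
  generalize (∑ j, C (D 3 j) * X j : MvPolynomial (Fin 4) ℂ) = l3
  simp only [coeff_mul_linear, coeff_one_equivFunOnFinite]
  simp [Fin.sum_univ_four, funext_iff, Fin.forall_fin_succ, Function.update_apply, hadamard]
  have h1 : (C (-1 / 2) : MvPolynomial (Fin 4) ℂ) = -C 2⁻¹ := by rw [← C_neg]; norm_num
  have h2 : (C (72 / 625) : MvPolynomial (Fin 4) ℂ) =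
      C 2 * (C (4 / 5) * C 2⁻¹) ^ 2 * C (3 / 5) ^ 2 := by
    simp only [← map_mul, ← map_pow]; norm_num
  rw [h1, h2, map_ofNat]
  ring

theorem exists_heralds_interferometer {Q : MvPolynomial (Fin 4) ℂ} (hQ : Q ∈ bellStates) :
    ∃ D : Matrix (Fin 4) (Fin 4) ℂ, D * D.conjTranspose = 1 ∧
      Heralds (interferometer D) (fock ![1, 1, 1, 1, 0, 0, 0, 0]) ![1, 1, 0, 0] Q := by
  have hs : (Real.sqrt 2 : ℂ) ≠ 0 := by exact_mod_cast (Real.sqrt_pos.2 two_pos).ne'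
  have hss : (C (Real.sqrt 2 : ℂ) : MvPolynomial (Fin 4) ℂ) * C ((Real.sqrt 2 : ℂ)⁻¹) = 1 := by
    rw [← C_mul, mul_inv_cancel₀ hs, C_1]
  have hα : (72 / 625 * Real.sqrt 2 : ℂ) ≠ 0 := mul_ne_zero (by norm_num) hs
  have hd : ∀ D : Matrix (Fin 4) (Fin 4) ℂ, D.map star = D → D * D.transpose = 1 →
      D * D.conjTranspose = 1 := fun D h1 h2 => by
    rwa [Matrix.conjTranspose, Matrix.transpose_map, h1]
  -- Signed permutations turn `l₁ l₃ - l₀ l₂` into each Bell form up to sign; `√2` cancels the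
  -- normalization of the target.
  rcases hQ with rfl | rfl | rfl | rfl
  on_goal 1 => refine ⟨!![-1, 0, 0, 0; 0, 1, 0, 0; 0, 0, 1, 0; 0, 0, 0, 1], ?_,
    72 / 625 * Real.sqrt 2, hα, ?_⟩
  on_goal 3 => refine ⟨1, ?_, -(72 / 625 * Real.sqrt 2), neg_ne_zero.2 hα, ?_⟩
  on_goal 5 => refine ⟨!![-1, 0, 0, 0; 0, 1, 0, 0; 0, 0, 0, 1; 0, 0, 1, 0], ?_,
    72 / 625 * Real.sqrt 2, hα, ?_⟩
  on_goal 7 => refine ⟨!![1, 0, 0, 0; 0, 1, 0, 0; 0, 0, 0, 1; 0, 0, 1, 0], ?_,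
    -(72 / 625 * Real.sqrt 2), neg_ne_zero.2 hα, ?_⟩
  all_goals first
    | rw [heralded_interferometer]
      simp [bell, fock, Fin.sum_univ_four, Fin.prod_univ_four]
      grind
    | refine hd _ ?_ ?_ <;> ext i j <;> fin_cases i <;> fin_cases j <;>
        simp [Matrix.mul_apply, Fin.sum_univ_four]

/-! ### The Nullstellensatz certificate -/

theorem heralded_three_photons {S : Type*} [CommRing S] [Algebra ℂ S]
    (A : Matrix (Fin (4 + 1)) (Fin (4 + 1)) S) :
    heralded A (fock ![1, 1, 1, 0, 0]) ![1] =
      C (A 0 4) * ((∑ j, C (A 1 (Fin.castAdd 1 j)) * X j) * ∑ j, C (A 2 (Fin.castAdd 1 j)) * X j) +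
      C (A 1 4) * ((∑ j, C (A 0 (Fin.castAdd 1 j)) * X j) * ∑ j, C (A 2 (Fin.castAdd 1 j)) * X j) +
      C (A 2 4) *
        ((∑ j, C (A 0 (Fin.castAdd 1 j)) * X j) * ∑ j, C (A 1 (Fin.castAdd 1 j)) * X j) := by
  have hf : (fock ![1, 1, 1, 0, 0] : MvPolynomial (Fin (4 + 1)) ℂ) = X 0 * X 1 * X 2 := by
    simp [fock, Fin.prod_univ_five]
  rw [heralded, splitModes_output, hf]
  simp only [map_mul (aeval _), aeval_X]
  rw [← one_mul (C (∑ j, C (A 0 (Fin.castAdd 1 j)) * X j) + _)]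
  simp only [coeff_mul_linear, coeff_one_equivFunOnFinite]
  simp [funext_iff, Function.update_apply]
  ring

/-- The exponents of the monomials of degree two in four variables. -/
def quadExponent : Fin 10 → Fin 4 → ℕ :=
  ![![2, 0, 0, 0], ![0, 2, 0, 0], ![0, 0, 2, 0], ![0, 0, 0, 2], ![1, 1, 0, 0], ![1, 0, 1, 0],
    ![1, 0, 0, 1], ![0, 1, 1, 0], ![0, 1, 0, 1], ![0, 0, 1, 1]]

theorem quadExponent_injective : Function.Injective quadExponent := by decide

/-- The coefficient at `quadExponent k` of the product of the linear forms `a` and `b`. -/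
noncomputable def polar {S : Type*} [CommRing S] (a b : Fin 4 → S) : Fin 10 → S :=
  ![a 0 * b 0, a 1 * b 1, a 2 * b 2, a 3 * b 3, a 0 * b 1 + a 1 * b 0, a 0 * b 2 + a 2 * b 0,
    a 0 * b 3 + a 3 * b 0, a 1 * b 2 + a 2 * b 1, a 1 * b 3 + a 3 * b 1, a 2 * b 3 + a 3 * b 2]

theorem coeff_linear_mul_linear {S : Type*} [CommRing S] (a b : Fin 4 → S) (k : Fin 10) :
    coeff (Finsupp.equivFunOnFinite.symm (quadExponent k))
      ((∑ j, C (a j) * X j) * ∑ j, C (b j) * X j) = polar a b k := by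
  have h : ∀ c : Fin 4 → S, (∑ j, C (c j) * X j : MvPolynomial (Fin 4) S) =
      C 0 + ∑ j, C (c j) * X j := fun c => by simp
  rw [h a, h b, ← one_mul (C 0 + ∑ j, C (a j) * X j)]
  simp only [coeff_mul_linear, coeff_one_equivFunOnFinite]
  fin_cases k <;>
    simp [quadExponent, polar, funext_iff, Fin.forall_fin_succ, Function.update_apply,
      Fin.sum_univ_four] <;> ring

/-- The Hessian of the quadratic form with coefficients `y`. -/
noncomputable def hessian {S : Type*} [CommRing S] (y : Fin 10 → S) : Matrix (Fin 4) (Fin 4) S :=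
  !![2 * y 0, y 4, y 5, y 6; y 4, 2 * y 1, y 7, y 8; y 5, y 7, 2 * y 2, y 9;
    y 6, y 8, y 9, 2 * y 3]

/-- A quadratic form in three linear forms has Hessian `Lᵀ B L`; padding to size four puts a zero
row in `B`. -/
theorem det_hessian_three {S : Type*} [CommRing S] (g c₀ c₁ c₂ : S) (a₀ a₁ a₂ : Fin 4 → S) :
    (hessian fun k => g * (c₀ * polar a₁ a₂ k + c₁ * polar a₀ a₂ k + c₂ * polar a₀ a₁ k)).det =
      0 := by
  have h : (hessian fun k => g * (c₀ * polar a₁ a₂ k + c₁ * polar a₀ a₂ k + c₂ * polar a₀ a₁ k)) =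
      (Matrix.of ![a₀, a₁, a₂, 0]).transpose *
        (!![0, g * c₂, g * c₁, 0; g * c₂, 0, g * c₀, 0; g * c₁, g * c₀, 0, 0; 0, 0, 0, 0] *
          Matrix.of ![a₀, a₁, a₂, 0]) := by
    ext i j
    fin_cases i <;> fin_cases j <;>
      simp [hessian, polar, Matrix.mul_apply, Fin.sum_univ_four] <;> ring
  rw [h, Matrix.det_mul, Matrix.det_transpose, Matrix.det_eq_zero_of_row_eq_zero 3 (by simp),
    zero_mul]

/-- The cofactors of a certificate: they express `det (hessian y) - s ^ 4` through the `y k`, less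
`s` if `k = 5` or `k = 8`. -/
noncomputable def cofactor {S : Type*} [CommRing S] (s : S) (y : Fin 10 → S) : Fin 10 → S :=
  ![16 • (y 1 * y 2 * y 3) - 4 • (y 1 * y 9 * y 9) - 4 • (y 2 * y 8 * y 8) -
      4 • (y 3 * y 7 * y 7) + 4 • (y 7 * y 8 * y 9),
    4 • (y 5 * y 6 * y 9) - 4 • (y 2 * y 6 * y 6) - 4 • (y 3 * y 5 * y 5),
    4 • (y 4 * y 6 * y 8) - 4 • (y 3 * y 4 * y 4),
    4 • (y 4 * y 5 * y 7),
    y 4 * y 9 * y 9 - 2 • (y 5 * y 8 * y 9) - 2 • (y 6 * y 7 * y 9),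
    y 8 * (y 5 * y 8 + s ^ 2),
    y 6 * y 7 * y 7 - 2 • (y 5 * y 7 * y 8),
    0,
    s * (y 5 * y 8 + s ^ 2),
    0]

/-- Every monomial of the determinant other than `(y 5 * y 8) ^ 2` contains some `y k` with `k ≠ 5,
8` and is charged to one such `k`. The rest is `(y 5 * y 8) ^ 2 - s ^ 4 = (y 5 * y 8 + s ^ 2) * (y 8
* (y 5 - s) + s * (y 8 - s))`. -/
theorem sum_cofactor {S : Type*} [CommRing S] (s : S) (y : Fin 10 → S) :
    ∑ k, cofactor s y k * (y k - if k = 5 ∨ k = 8 then s else 0) = (hessian y).det - s ^ 4 := by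
  simp [Fin.sum_univ_succ, cofactor, hessian, Matrix.det_succ_row_zero, Fin.succAbove]
  ring

theorem totalDegree_cofactor_le {σ : Type*} (s : ℂ) {y : Fin 10 → MvPolynomial σ ℂ}
    (hy : ∀ k, (y k).totalDegree ≤ 3) (k : Fin 10) : (cofactor (C s) y k).totalDegree ≤ 9 := by
  rw [← mem_restrictTotalDegree]
  have h2 : ∀ i j, y i * y j ∈ restrictTotalDegree σ ℂ 6 := fun i j =>
    (mem_restrictTotalDegree _ _ _).2 ((totalDegree_mul _ _).trans (add_le_add (hy i) (hy j)))
  have h3 : ∀ i j l, y i * y j * y l ∈ restrictTotalDegree σ ℂ 9 := fun i j l =>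
    (mem_restrictTotalDegree _ _ _).2 ((totalDegree_mul _ _).trans
      (add_le_add ((mem_restrictTotalDegree _ _ _).1 (h2 i j)) (hy l)))
  have hs : ∀ i j, (y i * y j + C s ^ 2).totalDegree ≤ 6 := fun i j =>
    (mem_restrictTotalDegree _ _ _).1 (add_mem (h2 i j)
      ((mem_restrictTotalDegree _ _ _).2 (by rw [← C_pow, totalDegree_C]; omega)))
  have h5 : y 8 * (y 5 * y 8 + C s ^ 2) ∈ restrictTotalDegree σ ℂ 9 :=
    (mem_restrictTotalDegree _ _ _).2
      ((totalDegree_mul _ _).trans (add_le_add (hy _) (hs _ _)))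
  have h8 : C s * (y 5 * y 8 + C s ^ 2) ∈ restrictTotalDegree σ ℂ 9 :=
    (mem_restrictTotalDegree _ _ _).2
      ((totalDegree_mul _ _).trans ((add_le_add (totalDegree_C s).le (hs _ _)).trans (by omega)))
  fin_cases k <;> simp only [cofactor, Fin.reduceFinMk, Fin.zero_eta, Fin.mk_one, Fin.isValue,
    Matrix.cons_val]
  all_goals
    with_reducible
    repeat' first
      | exact h3 _ _ _
      | exact h5
      | exact h8
      | exact zero_mem _
      | apply nsmul_mem
      | apply sub_mem
      | apply add_mem

/-- The leading part `y 5 * y 8 ^ 2` cannot vanish over a domain, so the bound 9 is attained. -/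
theorem totalDegree_cofactor_five {σ : Type*} (s : ℂ) {y : Fin 10 → MvPolynomial σ ℂ}
    (h5 : (y 5).totalDegree = 3) (h8 : (y 8).totalDegree = 3) :
    (cofactor (C s) y 5).totalDegree = 9 := by
  have n5 : y 5 ≠ 0 := fun h => by simp [h] at h5
  have n8 : y 8 ≠ 0 := fun h => by simp [h] at h8
  have h58 : (y 5 * y 8).totalDegree = 6 := by
    rw [totalDegree_mul_of_isDomain n5 n8, h5, h8]
  have h : (y 5 * y 8 + C s ^ 2).totalDegree = 6 := by
    rw [← C_pow, totalDegree_add_eq_left_of_totalDegree_lt (by rw [totalDegree_C, h58]; omega), h58]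
  have n : y 5 * y 8 + C s ^ 2 ≠ 0 := fun h' => by simp [h'] at h
  change (y 8 * (y 5 * y 8 + C s ^ 2)).totalDegree = 9
  rw [totalDegree_mul_of_isDomain n8 n, h8, h]

/-- A certificate that is supported on an injective family of equations. -/
theorem hasCertificateOfDegree_of_injective {ι κ σ K : Type*} [Field K] [Fintype κ]
    {t : Finset ι} {f : ι → MvPolynomial σ K} {d : ℕ} (e : κ → ι) (he : Function.Injective e)
    (het : ∀ k, e k ∈ t) (b : κ → MvPolynomial σ K) (hb : ∑ k, b k * f (e k) = 1)
    (hd : ∀ k, (b k).totalDegree ≤ d) (k₀ : κ) (hk₀ : (b k₀).totalDegree = d) :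
    HasCertificateOfDegree t f d := by
  classical
  have hβ := he.extend_apply b 0
  refine ⟨Function.extend e b 0, ?_, le_antisymm (Finset.sup_le fun i _ => ?_) ?_⟩
  · rw [← hb, ← Finset.sum_subset (s₁ := Finset.univ.image e)]
    · rw [Finset.sum_image fun i _ j _ h => he h]
      simp only [hβ]
    · intro i hi
      obtain ⟨k, -, rfl⟩ := Finset.mem_image.1 hi
      exact het k
    · intro i _ hi
      rw [Function.extend_apply' _ _ _ fun ⟨k, hk⟩ =>
        hi (Finset.mem_image.2 ⟨k, Finset.mem_univ _, hk⟩)]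
      simp
  · by_cases h : ∃ k, e k = i
    · obtain ⟨k, rfl⟩ := h
      rw [hβ]; exact hd k
    · rw [Function.extend_apply' _ _ _ h]; simp
  · rw [← hk₀, ← hβ k₀]
    exact Finset.le_sup (f := fun i => (Function.extend e b 0 i).totalDegree) (het k₀)

theorem coeff_bell (k : Fin 10) :
    coeff (Finsupp.equivFunOnFinite.symm (quadExponent k)) bell =
      if k = 5 ∨ k = 8 then (Real.sqrt 2 : ℂ)⁻¹ else 0 := by
  have h : bell = C ((Real.sqrt 2 : ℂ)⁻¹) * (1 * X 0 * X 2 + 1 * X 1 * X 3) := by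
    simp [bell, fock, Fin.prod_univ_four]
  rw [h]
  simp only [coeff_C_mul, coeff_add, coeff_mul_X_update, coeff_one_equivFunOnFinite]
  fin_cases k <;>
    simp [quadExponent, funext_iff, Fin.forall_fin_succ, Function.update_apply]

theorem isHomogeneous_polar {σ S : Type*} [CommRing S] {a b : Fin 4 → MvPolynomial σ S}
    (ha : ∀ j, (a j).IsHomogeneous 1) (hb : ∀ j, (b j).IsHomogeneous 1) (k : Fin 10) :
    (polar a b k).IsHomogeneous 2 := by
  have h : ∀ i j, (a i * b j).IsHomogeneous 2 := fun i j => (ha i).mul (hb j)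
  fin_cases k <;> first | exact h _ _ | exact (h _ _).add (h _ _)

theorem hasCertificateOfDegree_bell {γ : ℂ} (hγ : γ ≠ 0) :
    HasCertificateOfDegree (Finset.finsuppAntidiag (Finset.univ : Finset (Fin 4)) 2)
      (stateEquation (T := 4) (M := 1) γ (fock ![1, 1, 1, 0, 0]) ![1] bell) 9 := by
  let A := Matrix.mvPolynomialX (Fin (4 + 1)) (Fin (4 + 1)) ℂ
  let a : Fin 5 → Fin 4 → MvPolynomial (Fin (4 + 1) × Fin (4 + 1)) ℂ :=
    fun i j => A i (Fin.castAdd 1 j)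
  let y : Fin 10 → MvPolynomial (Fin (4 + 1) × Fin (4 + 1)) ℂ := fun k =>
    C γ * (A 0 4 * polar (a 1) (a 2) k + A 1 4 * polar (a 0) (a 2) k +
      A 2 4 * polar (a 0) (a 1) k)
  have hA : ∀ i j, (A i j).IsHomogeneous 1 := fun i j => isHomogeneous_X _ _
  have hy : ∀ k, (y k).IsHomogeneous 3 := fun k => by
    have h : ∀ i j l, (A i 4 * polar (a j) (a l) k).IsHomogeneous 3 := fun i j l =>
      (hA i 4).mul (isHomogeneous_polar (fun _ => hA _ _) (fun _ => hA _ _) k)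
    simpa using (isHomogeneous_C _ γ).mul (((h 0 1 2).add (h 1 0 2)).add (h 2 0 1))
  have hy58 : ∀ k, k = 5 ∨ k = 8 → (y k).totalDegree = 3 := fun k hk => by
    refine (hy k).totalDegree fun h => ?_
    -- With all matrix entries equal to `1`, both coefficients take the value `6γ ≠ 0`.
    have := congrArg (eval fun _ => (1 : ℂ)) h
    rcases hk with rfl | rfl <;>
      · simp [y, polar, a, A, Matrix.mvPolynomialX, hγ] at this
        norm_num at this
  have hf : ∀ k, stateEquation (T := 4) (M := 1) γ (fock ![1, 1, 1, 0, 0]) ![1] bell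
      (Finsupp.equivFunOnFinite.symm (quadExponent k)) =
        y k - if k = 5 ∨ k = 8 then C (Real.sqrt 2 : ℂ)⁻¹ else 0 := fun k => by
    rw [stateEquation, heralded_three_photons, coeff_bell]
    simp only [coeff_add, coeff_C_mul, coeff_linear_mul_linear, apply_ite C, map_zero]
    rfl
  have hs : (Real.sqrt 2 : ℂ)⁻¹ ^ 4 = 1 / 4 := by
    have : (Real.sqrt 2 : ℂ) ^ 2 = 2 := by exact_mod_cast Real.sq_sqrt two_pos.le
    rw [inv_pow, show (Real.sqrt 2 : ℂ) ^ 4 = ((Real.sqrt 2 : ℂ) ^ 2) ^ 2 by ring, this]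
    norm_num
  have hdeg : ∀ p : MvPolynomial (Fin (4 + 1) × Fin (4 + 1)) ℂ,
      (C (-4) * p).totalDegree = p.totalDegree := fun p => by
    rcases eq_or_ne p 0 with rfl | hp
    · simp
    · rw [totalDegree_mul_of_isDomain (C_ne_zero.2 (by norm_num)) hp, totalDegree_C, zero_add]
  -- The factor `-4` normalizes the sum, which is `0 - s ^ 4 = -1/4`.
  refine hasCertificateOfDegree_of_injective
    (fun k => Finsupp.equivFunOnFinite.symm (quadExponent k))
    (Finsupp.equivFunOnFinite.symm.injective.comp quadExponent_injective) (fun k => ?_)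
    (fun k => C (-4) * cofactor (C (Real.sqrt 2 : ℂ)⁻¹) y k) ?_ (fun k => ?_) 5 ?_
  · rw [Finset.mem_finsuppAntidiag]
    refine ⟨?_, Finset.subset_univ _⟩
    fin_cases k <;> simp [quadExponent, Fin.sum_univ_four]
  · simp only [hf, mul_assoc]
    rw [← Finset.mul_sum, sum_cofactor, det_hessian_three, ← C_pow, hs, zero_sub, ← C_neg, ← C_mul]
    norm_num
  · rw [hdeg]
    exact totalDegree_cofactor_le _ (fun k => (hy k).totalDegree_le) k
  · rw [hdeg]
    exact totalDegree_cofactor_five _ (hy58 5 (.inl rfl)) (hy58 8 (.inr rfl))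

end LinearOptics

theorem mainTheorem3 :
    -- a certificate of degree 9 for the ten equations `γ G = Q` (one for each monomial of degree 2)
    (∀ γ : ℂ, γ ≠ 0 →
      LinearOptics.HasCertificateOfDegree (Finset.finsuppAntidiag (Finset.univ : Finset (Fin 4)) 2)
        (LinearOptics.stateEquation (T := 4) (M := 1) γ (LinearOptics.fock ![1, 1, 1, 0, 0]) ![1]
          LinearOptics.bell) 9) ∧
    -- no linear transformation works for the input `|1,1,1,0,0⟩` heralded on one photon
    (∀ A : Matrix (Fin (4 + 1)) (Fin (4 + 1)) ℂ,
      ¬ LinearOptics.Heralds A (LinearOptics.fock ![1, 1, 1, 0, 0]) ![1] LinearOptics.bell) ∧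
    -- no separable three-photon input works, with any number of modes and any heralding pattern
    (∀ Q ∈ LinearOptics.bellStates, ∀ (M : ℕ) (R : MvPolynomial (Fin (4 + M)) ℂ),
      LinearOptics.IsSeparable 3 R →
        ∀ (m : Fin M → ℕ) (A : Matrix (Fin (4 + M)) (Fin (4 + M)) ℂ),
          ¬ LinearOptics.Heralds A R m Q) ∧
    -- four is the least photon number of a separable input, for general linear transformations
    (∀ Q ∈ LinearOptics.bellStates,
      IsLeast {n : ℕ | ∃ (M : ℕ) (R : MvPolynomial (Fin (4 + M)) ℂ) (m : Fin M → ℕ)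
        (A : Matrix (Fin (4 + M)) (Fin (4 + M)) ℂ),
          LinearOptics.IsSeparable n R ∧ LinearOptics.Heralds A R m Q} 4) ∧
    -- and also of a Fock state input, for unitary transformations
    (∀ Q ∈ LinearOptics.bellStates,
      IsLeast {n : ℕ | ∃ (M : ℕ) (k : Fin (4 + M) → ℕ) (m : Fin M → ℕ)
        (U : Matrix (Fin (4 + M)) (Fin (4 + M)) ℂ),
          ∑ i, k i = n ∧ U ∈ Matrix.unitaryGroup (Fin (4 + M)) ℂ ∧
            LinearOptics.Heralds U (LinearOptics.fock k) m Q} 4) := by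
  have hbell : LinearOptics.bell ∈ LinearOptics.bellStates := .inl rfl
  refine ⟨fun γ hγ => LinearOptics.hasCertificateOfDegree_bell hγ, fun A => ?_,
    fun Q hQ M R hR m A => hR.not_heralds hQ (by norm_num) m A, fun Q hQ => ⟨?_, ?_⟩,
    fun Q hQ => ⟨?_, ?_⟩⟩
  -- This follows from the general photon bound; the certificate is not needed.
  · refine (LinearOptics.isSeparable_fock (N := 4 + 1) ![1, 1, 1, 0, 0]).not_heralds hbell ?_ _ A
    simp [Fin.sum_univ_five]
  · obtain ⟨D, -, h⟩ := LinearOptics.exists_heralds_interferometer hQ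
    refine ⟨4, _, _, _, ?_, h⟩
    simpa [Fin.sum_univ_eight] using
      LinearOptics.isSeparable_fock (N := 4 + 4) ![1, 1, 1, 1, 0, 0, 0, 0]
  · rintro n ⟨M, R, m, A, hR, h⟩
    by_contra! hn
    exact hR.not_heralds hQ hn m A h
  · obtain ⟨D, hD, h⟩ := LinearOptics.exists_heralds_interferometer hQ
    exact ⟨4, _, _, _, by simp [Fin.sum_univ_eight],
      LinearOptics.interferometer_mem_unitaryGroup hD, h⟩
  · rintro n ⟨M, k, m, U, rfl, -, h⟩
    by_contra! hn
    exact (LinearOptics.isSeparable_fock k).not_heralds hQ hn m U h
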